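/- **Ulam words.** The binary words of length $1$ that are Ulam are $0$ and $1$; a binary word of length $n>1$ is Ulam if and only if there is exactly one pair $(u,v)$ of distinct Ulam words, each of length less than $n$, whose concatenation $uv$ is the word. For a nonnegative integer $y$ let $\mathrm{Ulam}[y]$ be the set of pairs $(x,z)$ of nonnegative integers such that the word $0^x1\,0^y1\,0^z$ is Ulam. A positive integer is called a *Zumkeller number* if its binary representation contains at most one $0$. **Theorem.** Let $k\ge 0$ and $2^k\le y<2^{k+1}$, and for nonnegative integers $x,z$ let $\tilde x,\tilde z\in\{0,\dots,2^{k+1}-1\}$ be their reductions modulo $2^{k+1}$. 1. If $y$ is not a Zumkeller number, then every $(x,z)\in\mathrm{Ulam}[y]$ satisfies $x+z\ge 2^{k+1}-1$. 2. If $y$ is not a Zumkeller number, then every $(x,z)\in\mathrm{Ulam}[y]$ satisfies $$2^{k+1}-1\le \tilde x+\tilde z\le 2^{k+2}-y-2.$$ If $y$ is a Zumkeller number, then every $(x,z)\in\mathrm{Ulam}[y]$ with $x+z\notin\{y,y+1,y+2\}$ satisfies the same inequalities. 3. If $y\notin\{2^{k+1}-1,2^{k+1}-2\}$, then $(x,z)\in\mathrm{Ulam}[y]$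 for all $x,z\ge0$ with $x+z\equiv-1\pmod{2^{k+1}}$. If $y=2^{k+1}-1$ or $y=2^{k+1}-2$, then a pair $(x,z)$ with $x+z\equiv-1\pmod{2^{k+1}}$ lies in $\mathrm{Ulam}[y]$ if and only if $x+z\ne 2^{k+1}-1$. 4. Let $s$ be the odd one of the two numbers $2^{k+2}-y-2$ and $2^{k+2}-y-3$. If $y\notin\{2^{k+1}-1,2^{k+1}-2\}$, then $(x,z)\in\mathrm{Ulam}[y]$ for all $x,z\ge0$ with $\tilde x+\tilde z=s$. If $y=2^{k+1}-1$ or $y=2^{k+1}-2$, then a pair $(x,z)$ with $\tilde x+\tilde z=s$ lies in $\mathrm{Ulam}[y]$ if and only if $x+z\ne 2^{k+1}-1$. -/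

import Mathlib

namespace BinaryUlam

/-- The set of Ulam words of length `n` over the alphabet `{0, 1}`. The only ones of length one
are `0` and `1`; a word of length `n > 1` is Ulam if exactly one pair of distinct Ulam words of
smaller lengths concatenates to it. -/
def ulamLevel : ℕ → Set (List (Fin 2))
  | 0 => ∅
  | 1 => {[0], [1]}
  | n + 2 =>
    {w | w.length = n + 2 ∧
      ∃! p : List (Fin 2) × List (Fin 2),
        p.1 ++ p.2 = w ∧ p.1 ≠ p.2 ∧
        (∃ i, ∃ _ : i < n + 2, p.1 ∈ ulamLevel i) ∧
        (∃ j, ∃ _ : j < n + 2, p.2 ∈ ulamLevel j)}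
termination_by n => n

/-- A word is Ulam if it lies in one of the levels. -/
def IsUlamWord (w : List (Fin 2)) : Prop := ∃ n, w ∈ ulamLevel n

/-- The word `0^x 1 0^y 1 0^z`. -/
def word (x y z : ℕ) : List (Fin 2) :=
  List.replicate x 0 ++ [1] ++ List.replicate y 0 ++ [1] ++ List.replicate z 0

/-- The set `Ulam[y]` of all `(x, z)` for which `0^x 1 0^y 1 0^z` is an Ulam word. -/
def ulamSet (y : ℕ) : Set (ℕ × ℕ) := {p | IsUlamWord (word p.1 y p.2)}

/-- A positive integer with at most one `0` in its binary representation. -/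
def IsZumkeller (y : ℕ) : Prop := 0 < y ∧ (Nat.digits 2 y).count 0 ≤ 1

end BinaryUlam

/-! The only Ulam word without a one is `0`, so a cut inside an outer block of zeros must strip a
single zero. For words with one `1`, unique decomposition thus becomes Pascal's recurrence modulo
two, and 0^a 1 0^b is Ulam exactly when a and b have disjoint binary supports. For 0^x 1 0^y 1 0^z
it becomes a recurrence along the antidiagonals of (x, z): the indicators of (x - 1, z) and (x, z -
1) plus the number of cuts between the ones must total one. That number is `reps x z y`, which
depends only on x and z modulo T = 2^(k+1), except that a cut into equal halves is lost when x + z =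
y and x, z are disjoint.

Without this exception the recurrence has the periodic solution `Generic` (`generic_iff_sum`). Digit
recursions for `reps` supply the inputs: it is never 1 when the residues sum to less than T - 1
(`reps_ne_one`), it is 1 when they sum to T - 1 (`reps_complement`) and at the upper edge
(`reps_extremal`), it is 0 beyond that edge, and inside the band neighbouring values are linked by
`reps_pred_eq_of_zero` and `reps_pred_of_one`.

`ulamSet y` and `Generic` agree before antidiagonal y, and agree from any later antidiagonal on
which they coincide. If y + 3 ≤ T, the lost cut affects antidiagonal y alone, and a member there has
`reps` equal to 2, which forces y to be Zumkeller. For y = T - 1 and y = T - 2 the disturbance is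
followed explicitly until it dies out, by antidiagonals y + 1 and y + 3 respectively. -/

namespace BinaryUlam

open Finset

/-! ### Disjoint binary supports and Pascal's triangle modulo two -/

open Classical in
/-- The indicator of a proposition. -/
noncomputable def ind (p : Prop) : ℕ := if p then 1 else 0

lemma ind_true {p : Prop} (h : p) : ind p = 1 := if_pos h

lemma ind_false {p : Prop} (h : ¬ p) : ind p = 0 := if_neg h

lemma ind_congr {p q : Prop} (h : p ↔ q) : ind p = ind q := by rw [propext h]

/-- Disjointness of the binary supports. -/
def BitDisjoint (a b : ℕ) : Prop := a &&& b = 0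

lemma bitDisjoint_iff (a b : ℕ) :
    BitDisjoint a b ↔ ¬ (a % 2 = 1 ∧ b % 2 = 1) ∧ BitDisjoint (a / 2) (b / 2) := by
  unfold BitDisjoint
  have h1 : (a &&& b) / 2 = a / 2 &&& b / 2 := Nat.and_div_two
  have h2 : (a &&& b) % 2 = 1 ↔ a % 2 = 1 ∧ b % 2 = 1 := Nat.and_mod_two_eq_one
  rw [← h1, ← h2]
  omega

lemma BitDisjoint.symm {a b : ℕ} (h : BitDisjoint a b) : BitDisjoint b a := by
  unfold BitDisjoint at *
  rwa [Nat.and_comm]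

lemma bitDisjoint_comm (a b : ℕ) : BitDisjoint a b ↔ BitDisjoint b a := ⟨.symm, .symm⟩

@[simp] lemma bitDisjoint_zero_left (b : ℕ) : BitDisjoint 0 b := by simp [BitDisjoint]

@[simp] lemma bitDisjoint_zero_right (b : ℕ) : BitDisjoint b 0 := by simp [BitDisjoint]

lemma bitDisjoint_even_even (a b : ℕ) : BitDisjoint (2 * a) (2 * b) ↔ BitDisjoint a b := by
  rw [bitDisjoint_iff]; simp

lemma bitDisjoint_odd_even (a b : ℕ) : BitDisjoint (2 * a + 1) (2 * b) ↔ BitDisjoint a b := by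
  rw [bitDisjoint_iff, show (2 * a + 1) / 2 = a by omega]; simp

lemma bitDisjoint_even_odd (a b : ℕ) : BitDisjoint (2 * a) (2 * b + 1) ↔ BitDisjoint a b := by
  rw [bitDisjoint_comm, bitDisjoint_odd_even, bitDisjoint_comm]

lemma not_bitDisjoint_odd_odd (a b : ℕ) : ¬ BitDisjoint (2 * a + 1) (2 * b + 1) := by
  rw [bitDisjoint_iff]; omega

lemma bitDisjoint_mod {n i : ℕ} (a : ℕ) (hi : i < 2 ^ n) :
    BitDisjoint (a % 2 ^ n) i ↔ BitDisjoint a i := by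
  unfold BitDisjoint
  rw [← Nat.and_two_pow_sub_one_eq_mod, Nat.and_assoc, Nat.and_comm (2 ^ n - 1) i,
    Nat.and_two_pow_sub_one_eq_mod, Nat.mod_eq_of_lt hi]

lemma two_mul_sub_one {n : ℕ} (h : 1 ≤ n) : 2 * n - 1 = 2 * (n - 1) + 1 := by omega

/-- The Pascal recurrence modulo two, for supports. -/
lemma bitDisjoint_pascal (a b : ℕ) (h : 1 ≤ a + b) :
    BitDisjoint a b ↔
      ind (1 ≤ a ∧ BitDisjoint (a - 1) b) + ind (1 ≤ b ∧ BitDisjoint a (b - 1)) = 1 := by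
  induction a using Nat.strong_induction_on generalizing b with
  | _ a ih =>
  rcases Nat.even_or_odd' a with ⟨c, rfl | rfl⟩ <;> rcases Nat.even_or_odd' b with ⟨d, rfl | rfl⟩
  · rcases Nat.eq_zero_or_pos c with rfl | hc
    · simp [ind_false, ind_true (show 1 ≤ 2 * d by omega)]
    rw [bitDisjoint_even_even, ih c (by omega) d (by omega)]
    have e1 : (1 ≤ 2 * c ∧ BitDisjoint (2 * c - 1) (2 * d)) ↔
        (1 ≤ c ∧ BitDisjoint (c - 1) d) := by
      rw [two_mul_sub_one hc, bitDisjoint_odd_even]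
      exact and_congr_left fun _ => by omega
    have e2 : (1 ≤ 2 * d ∧ BitDisjoint (2 * c) (2 * d - 1)) ↔
        (1 ≤ d ∧ BitDisjoint c (d - 1)) := by
      rcases Nat.eq_zero_or_pos d with rfl | hd
      · simp
      rw [two_mul_sub_one hd, bitDisjoint_even_odd]
      exact and_congr_left fun _ => by omega
    rw [ind_congr e1, ind_congr e2]
  · have e1 : ¬ (1 ≤ 2 * c ∧ BitDisjoint (2 * c - 1) (2 * d + 1)) := by
      rintro ⟨hc, h⟩
      rw [two_mul_sub_one (by omega)] at h
      exact not_bitDisjoint_odd_odd _ _ h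
    rw [ind_false e1, bitDisjoint_even_odd, Nat.add_sub_cancel, bitDisjoint_even_even]
    by_cases hd : BitDisjoint c d <;> simp [hd, ind]
  · have e1 : ¬ (1 ≤ 2 * d ∧ BitDisjoint (2 * c + 1) (2 * d - 1)) := by
      rintro ⟨hc, h⟩
      rw [two_mul_sub_one (by omega)] at h
      exact not_bitDisjoint_odd_odd _ _ h
    rw [ind_false e1, bitDisjoint_odd_even, Nat.add_sub_cancel, bitDisjoint_even_even]
    by_cases hd : BitDisjoint c d <;> simp [hd, ind]
  · rw [Nat.add_sub_cancel, Nat.add_sub_cancel, bitDisjoint_even_odd, bitDisjoint_odd_even]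
    have := not_bitDisjoint_odd_odd c d
    by_cases hd : BitDisjoint c d <;> simp [hd, ind, this]

lemma bitDisjoint_sub_one {x z : ℕ} (hx : 1 ≤ x) (hz : 1 ≤ z) (h : ¬ BitDisjoint x z) :
    BitDisjoint (x - 1) z ↔ BitDisjoint x (z - 1) := by
  have := mt (bitDisjoint_pascal x z (by omega)).2 h
  by_cases h1 : BitDisjoint (x - 1) z <;> by_cases h2 : BitDisjoint x (z - 1) <;>
    simp [h1, h2, ind, hx, hz] at this ⊢

/-! ### The representation count and its recursion on binary digits -/

/-- The number of ways to write `y = i + j` with `i` disjoint from `x` and `j` disjoint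
from `z`. -/
noncomputable def reps (x z y : ℕ) : ℕ :=
  ∑ i ∈ range (y + 1), ind (BitDisjoint x i ∧ BitDisjoint (y - i) z)

lemma sum_range_two_mul (f : ℕ → ℕ) (n : ℕ) :
    ∑ i ∈ range (2 * n), f i = ∑ i ∈ range n, (f (2 * i) + f (2 * i + 1)) := by
  induction n with
  | zero => simp
  | succ n ih => rw [Nat.mul_succ, sum_range_succ, sum_range_succ, ih, sum_range_succ, add_assoc]

lemma reps_zero (x z : ℕ) : reps x z 0 = 1 := by simp [reps, ind_true]

lemma reps_comm (x z y : ℕ) : reps x z y = reps z x y := by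
  unfold reps
  rw [← sum_range_reflect]
  refine sum_congr rfl fun i hi => ind_congr ?_
  have hi := mem_range.1 hi
  rw [show y + 1 - 1 - i = y - i by omega, show y - (y - i) = i by omega, and_comm,
    bitDisjoint_comm i, bitDisjoint_comm x]

lemma reps_two_mul_add_one (x z y : ℕ) :
    reps x z (2 * y + 1) =
      ∑ i ∈ range (y + 1), (ind (BitDisjoint x (2 * i) ∧ BitDisjoint (2 * (y - i) + 1) z) +
        ind (BitDisjoint x (2 * i + 1) ∧ BitDisjoint (2 * (y - i)) z)) := by
  unfold reps
  rw [show 2 * y + 1 + 1 = 2 * (y + 1) by ring, sum_range_two_mul]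
  refine sum_congr rfl fun i hi => ?_
  have hi := mem_range.1 hi
  rw [show 2 * y + 1 - 2 * i = 2 * (y - i) + 1 by omega,
    show 2 * y + 1 - (2 * i + 1) = 2 * (y - i) by omega]

lemma reps_two_mul (x z y : ℕ) :
    reps x z (2 * y) =
      ∑ i ∈ range (y + 1), ind (BitDisjoint x (2 * i) ∧ BitDisjoint (2 * (y - i)) z) +
      ∑ i ∈ range y, ind (BitDisjoint x (2 * i + 1) ∧ BitDisjoint (2 * (y - 1 - i) + 1) z) := by
  unfold reps
  rw [sum_range_succ, sum_range_two_mul, sum_add_distrib, sum_range_succ _ y, Nat.sub_self,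
    Nat.sub_self, add_right_comm]
  congr 1
  · congr 1
    refine sum_congr rfl fun i hi => ?_
    have hi := mem_range.1 hi
    rw [show 2 * y - 2 * i = 2 * (y - i) by omega]
  · refine sum_congr rfl fun i hi => ?_
    have hi := mem_range.1 hi
    rw [show 2 * y - (2 * i + 1) = 2 * (y - 1 - i) + 1 by omega]

lemma reps_even_even_odd (x z y : ℕ) :
    reps (2 * x) (2 * z) (2 * y + 1) = 2 * reps x z y := by
  rw [reps_two_mul_add_one, reps, mul_sum]
  simp only [bitDisjoint_even_even, bitDisjoint_even_odd, bitDisjoint_odd_even, two_mul (ind _)]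

lemma reps_even_even_even (x z y : ℕ) :
    reps (2 * x) (2 * z) (2 * (y + 1)) = reps x z (y + 1) + reps x z y := by
  rw [reps_two_mul, reps, reps]
  simp only [bitDisjoint_even_even, bitDisjoint_even_odd, bitDisjoint_odd_even,
    Nat.add_sub_cancel]

lemma reps_odd_even_odd (x z y : ℕ) : reps (2 * x + 1) (2 * z) (2 * y + 1) = reps x z y := by
  rw [reps_two_mul_add_one, reps]
  simp [bitDisjoint_odd_even, not_bitDisjoint_odd_odd, ind_false]

lemma reps_odd_even_even (x z y : ℕ) : reps (2 * x + 1) (2 * z) (2 * y) = reps x z y := by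
  rw [reps_two_mul, reps]
  simp [bitDisjoint_odd_even, bitDisjoint_even_even, not_bitDisjoint_odd_odd, ind_false]

lemma reps_even_odd_odd (x z y : ℕ) : reps (2 * x) (2 * z + 1) (2 * y + 1) = reps x z y := by
  rw [reps_comm, reps_odd_even_odd, reps_comm]

lemma reps_even_odd_even (x z y : ℕ) : reps (2 * x) (2 * z + 1) (2 * y) = reps x z y := by
  rw [reps_comm, reps_odd_even_even, reps_comm]

lemma reps_odd_odd_odd (x z y : ℕ) : reps (2 * x + 1) (2 * z + 1) (2 * y + 1) = 0 := by
  rw [reps_two_mul_add_one]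
  simp [not_bitDisjoint_odd_odd, ind_false]

lemma reps_odd_odd_even (x z y : ℕ) : reps (2 * x + 1) (2 * z + 1) (2 * y) = reps x z y := by
  rw [reps_two_mul, reps]
  simp [bitDisjoint_odd_even, bitDisjoint_even_odd, not_bitDisjoint_odd_odd, ind_false]

/-- Both summands of y lie below 2^n, so higher bits of x and z cannot meet them. This is the source
of periodicity. -/
lemma reps_mod {n y : ℕ} (x z : ℕ) (hy : y < 2 ^ n) :
    reps (x % 2 ^ n) (z % 2 ^ n) y = reps x z y := by
  unfold reps
  refine sum_congr rfl fun i hi => ind_congr ?_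
  have hi := mem_range.1 hi
  rw [bitDisjoint_mod _ (by omega), bitDisjoint_comm _ z, bitDisjoint_comm _ (z % _),
    bitDisjoint_mod _ (by omega)]

lemma reps_pos_of_left_zero (z y : ℕ) : 1 ≤ reps 0 z y := by
  unfold reps
  rw [sum_range_succ]
  simp [ind]

lemma reps_pos {x z : ℕ} (y : ℕ) (h : BitDisjoint x z) : 1 ≤ reps x z y := by
  induction y using Nat.strong_induction_on generalizing x z with
  | _ y ih =>
  rcases Nat.eq_zero_or_pos y with rfl | hy
  · rw [reps_zero]
  rcases Nat.even_or_odd' x with ⟨a, rfl | rfl⟩ <;>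
    rcases Nat.even_or_odd' z with ⟨b, rfl | rfl⟩ <;>
    rcases Nat.even_or_odd' y with ⟨w, rfl | rfl⟩
  · obtain ⟨w, rfl⟩ : ∃ v, w = v + 1 := ⟨w - 1, by omega⟩
    rw [reps_even_even_even]
    have := ih w (by omega) ((bitDisjoint_even_even _ _).1 h)
    omega
  · rw [reps_even_even_odd]
    have := ih w (by omega) ((bitDisjoint_even_even _ _).1 h)
    omega
  · rw [reps_even_odd_even]
    exact ih w (by omega) ((bitDisjoint_even_odd _ _).1 h)
  · rw [reps_even_odd_odd]
    exact ih w (by omega) ((bitDisjoint_even_odd _ _).1 h)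
  · rw [reps_odd_even_even]
    exact ih w (by omega) ((bitDisjoint_odd_even _ _).1 h)
  · rw [reps_odd_even_odd]
    exact ih w (by omega) ((bitDisjoint_odd_even _ _).1 h)
  · exact absurd h (not_bitDisjoint_odd_odd _ _)
  · exact absurd h (not_bitDisjoint_odd_odd _ _)

/-- Pascal's rule gives reps x (z - 1) (y + 1) ≡ reps x z (y + 1) + reps x z y modulo two. The digit
recursion upgrades this to an equality when the first term on the right vanishes. -/
lemma reps_pred_right {x z y : ℕ} (hz : 1 ≤ z) (h : reps x z (y + 1) = 0) :
    reps x (z - 1) (y + 1) = reps x z y := by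
  induction y using Nat.strong_induction_on generalizing x z with
  | _ y ih =>
  rcases Nat.even_or_odd' x with ⟨a, rfl | rfl⟩ <;>
    rcases Nat.even_or_odd' z with ⟨b, rfl | rfl⟩ <;>
    rcases Nat.even_or_odd' y with ⟨w, rfl | rfl⟩
  · rw [two_mul_sub_one (by omega), reps_even_odd_odd]
    rw [reps_even_even_odd] at h
    rcases w with _ | v
    · simp [reps_zero] at h
    rw [reps_even_even_even, ih v (by omega) (by omega) (by omega)]
    omega
  · rw [show 2 * w + 1 + 1 = 2 * (w + 1) by ring] at h ⊢
    rw [two_mul_sub_one (by omega), reps_even_odd_even, reps_even_even_odd]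
    rw [reps_even_even_even] at h
    rw [ih w (by omega) (by omega) (by omega)]
    omega
  · rw [Nat.add_sub_cancel, reps_even_even_odd, reps_even_odd_even]
    rw [reps_even_odd_odd] at h
    omega
  · rw [show 2 * w + 1 + 1 = 2 * (w + 1) by ring] at h ⊢
    rw [Nat.add_sub_cancel, reps_even_even_even, reps_even_odd_odd]
    rw [reps_even_odd_even] at h
    omega
  · rw [two_mul_sub_one (by omega), reps_odd_odd_odd, reps_odd_even_even]
    rw [reps_odd_even_odd] at h
    omega
  · rw [show 2 * w + 1 + 1 = 2 * (w + 1) by ring] at h ⊢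
    rw [two_mul_sub_one (by omega), reps_odd_odd_even, reps_odd_even_odd]
    rw [reps_odd_even_even] at h
    exact ih w (by omega) (by omega) h
  · rw [Nat.add_sub_cancel, reps_odd_even_odd, reps_odd_odd_even]
  · rw [show 2 * w + 1 + 1 = 2 * (w + 1) by ring] at h ⊢
    rw [Nat.add_sub_cancel, reps_odd_even_even, reps_odd_odd_odd]
    rwa [reps_odd_odd_even] at h

lemma reps_pred_left {x z y : ℕ} (hx : 1 ≤ x) (h : reps x z (y + 1) = 0) :
    reps (x - 1) z (y + 1) = reps x z y := by
  rw [reps_comm, reps_comm x]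
  exact reps_pred_right hx (by rwa [reps_comm])

lemma reps_pred_eq_of_zero {x z y : ℕ} (hx : 1 ≤ x) (hz : 1 ≤ z) (h : reps x z y = 0) :
    reps (x - 1) z y = reps x (z - 1) y := by
  rcases y with _ | y
  · simp [reps_zero] at h
  rw [reps_pred_left hx h, reps_pred_right hz h]

/-- Auxiliary to `reps_pred_of_one`. No parity of x + z is assumed, since halving x and z does not
preserve it; the vanishing at y takes its place. -/
lemma reps_pred_of_one_of_zero {x z y : ℕ} (hx : 1 ≤ x) (hz : 1 ≤ z)
    (h1 : reps x z (y + 1) = 1) (h0 : reps x z y = 0) :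
    reps (x - 1) z (y + 1) = 1 ∨ reps x (z - 1) (y + 1) = 1 := by
  induction y using Nat.strong_induction_on generalizing x z with
  | _ y ih =>
  rcases Nat.even_or_odd' x with ⟨a, rfl | rfl⟩ <;>
    rcases Nat.even_or_odd' z with ⟨b, rfl | rfl⟩ <;>
    rcases Nat.even_or_odd' y with ⟨w, rfl | rfl⟩
  · rw [reps_even_even_odd] at h1
    omega
  · rw [show 2 * w + 1 + 1 = 2 * (w + 1) by ring] at h1 ⊢
    rw [reps_even_even_even] at h1
    rw [reps_even_even_odd] at h0
    rw [two_mul_sub_one (by omega), two_mul_sub_one (by omega), reps_even_odd_even,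
      reps_odd_even_even]
    exact ih w (by omega) (by omega) (by omega) (by omega) (by omega)
  · rw [reps_even_odd_even] at h0
    rw [reps_even_odd_odd] at h1
    omega
  · rw [show 2 * w + 1 + 1 = 2 * (w + 1) by ring] at h1 ⊢
    rw [reps_even_odd_even] at h1
    rw [reps_even_odd_odd] at h0
    right
    rw [Nat.add_sub_cancel, reps_even_even_even]
    omega
  · rw [reps_odd_even_even] at h0
    rw [reps_odd_even_odd] at h1
    omega
  · rw [show 2 * w + 1 + 1 = 2 * (w + 1) by ring] at h1 ⊢
    rw [reps_odd_even_even] at h1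
    rw [reps_odd_even_odd] at h0
    left
    rw [Nat.add_sub_cancel, reps_even_even_even]
    omega
  · rw [reps_odd_odd_odd] at h1
    omega
  · rw [show 2 * w + 1 + 1 = 2 * (w + 1) by ring] at h1 ⊢
    rw [reps_odd_odd_even] at h1
    left
    rwa [Nat.add_sub_cancel, reps_even_odd_even]

lemma reps_pred_of_one {x z y : ℕ} (hx : 1 ≤ x) (hz : 1 ≤ z) (hxz : Even (x + z))
    (h : reps x z y = 1) : reps (x - 1) z y = 1 ∨ reps x (z - 1) y = 1 := by
  rcases y with _ | y
  · simp [reps_zero]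
  rcases Nat.even_or_odd' x with ⟨a, rfl | rfl⟩ <;> rcases Nat.even_or_odd' z with ⟨b, rfl | rfl⟩
  · rcases Nat.even_or_odd' y with ⟨w, rfl | rfl⟩
    · rw [reps_even_even_odd] at h
      omega
    · rw [show 2 * w + 1 + 1 = 2 * (w + 1) by ring] at h ⊢
      rw [reps_even_even_even] at h
      rw [two_mul_sub_one (by omega), two_mul_sub_one (by omega), reps_even_odd_even,
        reps_odd_even_even]
      rcases Nat.eq_zero_or_pos (reps a b (w + 1)) with h0 | h0
      · left
        rw [reps_pred_left (by omega) h0]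
        omega
      · exact reps_pred_of_one_of_zero (by omega) (by omega) (by omega) (by omega)
  · rw [Nat.even_iff] at hxz; omega
  · rw [Nat.even_iff] at hxz; omega
  · rcases Nat.even_or_odd' y with ⟨w, rfl | rfl⟩
    · rw [reps_odd_odd_odd] at h
      omega
    · rw [show 2 * w + 1 + 1 = 2 * (w + 1) by ring] at h ⊢
      left
      rwa [Nat.add_sub_cancel, reps_even_odd_even, ← reps_odd_odd_even]

/-! ### Values of the count forced by the size of x + z -/

lemma reps_complement {n x z y : ℕ} (h : x + z + 1 = 2 ^ n) (hy : y < 2 ^ n) :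
    reps x z y = 1 := by
  induction n generalizing x z y with
  | zero =>
    obtain rfl : y = 0 := by simpa using hy
    exact reps_zero _ _
  | succ n ih =>
    rw [pow_succ] at h hy
    rcases Nat.even_or_odd' x with ⟨a, rfl | rfl⟩ <;>
      rcases Nat.even_or_odd' z with ⟨b, rfl | rfl⟩
    · omega
    · rcases Nat.even_or_odd' y with ⟨w, rfl | rfl⟩
      · rw [reps_even_odd_even]; exact ih (by omega) (by omega)
      · rw [reps_even_odd_odd]; exact ih (by omega) (by omega)
    · rcases Nat.even_or_odd' y with ⟨w, rfl | rfl⟩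
      · rw [reps_odd_even_even]; exact ih (by omega) (by omega)
      · rw [reps_odd_even_odd]; exact ih (by omega) (by omega)
    · omega

lemma reps_ne_one {k x z y : ℕ} (h : x + z + 2 ≤ 2 ^ (k + 1)) (hy : 2 ^ k ≤ y)
    (hy' : y < 2 ^ (k + 1)) : reps x z y ≠ 1 := by
  induction k generalizing x z y with
  | zero =>
    obtain rfl : y = 2 * 0 + 1 := by simp at hy hy'; omega
    obtain rfl : x = 2 * 0 := by simp at h; omega
    obtain rfl : z = 2 * 0 := by simp at h; omega
    rw [reps_even_even_odd]
    omega
  | succ n ih =>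
    have hpow : 2 ^ (n + 1) = 2 ^ n * 2 := pow_succ 2 n
    rw [pow_succ] at h hy'
    rcases Nat.even_or_odd' x with ⟨a, rfl | rfl⟩ <;>
      rcases Nat.even_or_odd' z with ⟨b, rfl | rfl⟩ <;>
      rcases Nat.even_or_odd' y with ⟨w, rfl | rfl⟩
    · obtain ⟨w, rfl⟩ : ∃ v, w = v + 1 := ⟨w - 1, by have := Nat.two_pow_pos n; omega⟩
      rw [reps_even_even_even]
      rcases Nat.lt_or_ge (2 ^ (n + 1)) (a + b + 2) with hab | hab
      · rw [reps_complement (n := n + 1) (by omega) (by omega),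
          reps_complement (n := n + 1) (by omega) (by omega)]
        omega
      · have h1 := ih (x := a) (z := b) (y := w + 1) hab (by omega) (by omega)
        intro hs
        have h0 : reps a b (w + 1) = 0 := by omega
        rcases Nat.eq_zero_or_pos b with rfl | hb
        · have := reps_pos (w + 1) (bitDisjoint_zero_right a)
          omega
        · have := ih (x := a) (z := b - 1) (y := w + 1) (by omega) (by omega) (by omega)
          rw [reps_pred_right hb h0] at this
          omega
    · rw [reps_even_even_odd]
      omega
    · rw [reps_even_odd_even]; exact ih (by omega) (by omega) (by omega)
    · rw [reps_even_odd_odd]; exact ih (by omega) (by omega) (by omega)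
    · rw [reps_odd_even_even]; exact ih (by omega) (by omega) (by omega)
    · rw [reps_odd_even_odd]; exact ih (by omega) (by omega) (by omega)
    · rw [reps_odd_odd_even]; exact ih (by omega) (by omega) (by omega)
    · rw [reps_odd_odd_odd]
      omega

lemma add_lt_of_bitDisjoint {n a b : ℕ} (ha : a < 2 ^ n) (hb : b < 2 ^ n)
    (h : BitDisjoint a b) : a + b < 2 ^ n := by
  induction n generalizing a b with
  | zero => simp at *; omega
  | succ n ih =>
    rw [pow_succ] at *
    obtain ⟨h1, h2⟩ := (bitDisjoint_iff a b).1 h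
    have := ih (by omega) (by omega) h2
    omega

/-- Disjoint numbers below 2^n add up to less than 2^n; adding the bounds for x + i and (y - i) + z
contradicts the size of x + z + y. -/
lemma reps_eq_zero {n x z y : ℕ} (hx : x < 2 ^ n) (hz : z < 2 ^ n) (hy : y < 2 ^ n)
    (h : 2 * 2 ^ n < x + z + y + 2) : reps x z y = 0 := by
  refine sum_eq_zero fun i hi => ind_false ?_
  rintro ⟨h1, h2⟩
  have hi := mem_range.1 hi
  have := add_lt_of_bitDisjoint hx (by omega) h1
  have := add_lt_of_bitDisjoint (by omega) hz h2
  omega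

lemma reps_extremal {n x z y : ℕ} (hx : x < 2 ^ n) (hz : z < 2 ^ n) (hy : y < 2 ^ n)
    (h : x + z + y + 2 = 2 * 2 ^ n) : reps x z y = 1 := by
  induction n generalizing x z y with
  | zero =>
    obtain rfl : y = 0 := by simpa using hy
    exact reps_zero _ _
  | succ n ih =>
    rw [pow_succ] at h hx hy hz
    rcases Nat.even_or_odd' x with ⟨a, rfl | rfl⟩ <;>
      rcases Nat.even_or_odd' z with ⟨b, rfl | rfl⟩ <;>
      rcases Nat.even_or_odd' y with ⟨w, rfl | rfl⟩
    · obtain ⟨w, rfl⟩ : ∃ v, w = v + 1 := ⟨w - 1, by omega⟩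
      rw [reps_even_even_even, ih (y := w) (by omega) (by omega) (by omega) (by omega),
        reps_eq_zero (n := n) (by omega) (by omega) (by omega) (by omega)]
    · omega
    · omega
    · rw [reps_even_odd_odd]; exact ih (by omega) (by omega) (by omega) (by omega)
    · omega
    · rw [reps_odd_even_odd]; exact ih (by omega) (by omega) (by omega) (by omega)
    · rw [reps_odd_odd_even]; exact ih (by omega) (by omega) (by omega) (by omega)
    · omega

lemma reps_subextremal {n x z y : ℕ} (hx : x < 2 ^ n) (hz : z < 2 ^ n) (hy : y < 2 ^ n)
    (h : x + z + y + 3 = 2 * 2 ^ n) (hxz : Odd (x + z)) : reps x z y = 1 := by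
  rw [Nat.odd_iff] at hxz
  obtain ⟨n, rfl⟩ : ∃ m, n = m + 1 := by
    rcases n with _ | m
    · simp at *
    · exact ⟨m, rfl⟩
  rw [pow_succ] at h hx hy hz
  obtain ⟨w, rfl⟩ : ∃ w, y = 2 * w := ⟨y / 2, by omega⟩
  rcases Nat.even_or_odd' x with ⟨a, rfl | rfl⟩ <;>
    rcases Nat.even_or_odd' z with ⟨b, rfl | rfl⟩
  · omega
  · rw [reps_even_odd_even]
    exact reps_extremal (n := n) (by omega) (by omega) (by omega) (by omega)
  · rw [reps_odd_even_even]
    exact reps_extremal (n := n) (by omega) (by omega) (by omega) (by omega)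
  · omega

/-- The bits of y are shared out between x and z. At a zero digit both are even, and the even
recursion adds a second term, positive by `reps_pos`; each zero digit therefore raises the count by
at least one. -/
lemma count_zero_digits_lt_reps {x z y : ℕ} (hy : 1 ≤ y) (h : BitDisjoint x z)
    (hxz : x + z = y) : (Nat.digits 2 y).count 0 < reps x z y := by
  induction y using Nat.strong_induction_on generalizing x z with
  | _ y ih =>
  rw [Nat.digits_def' (by norm_num) hy, List.count_cons]
  rcases Nat.even_or_odd' x with ⟨a, rfl | rfl⟩ <;>
    rcases Nat.even_or_odd' z with ⟨b, rfl | rfl⟩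
  · obtain ⟨w, rfl⟩ : ∃ w, y = 2 * (w + 1) := ⟨y / 2 - 1, by omega⟩
    rw [bitDisjoint_even_even] at h
    have h1 := ih (w + 1) (by omega) (by omega) h (by omega)
    have h2 := reps_pos w h
    rw [reps_even_even_even, show 2 * (w + 1) / 2 = w + 1 by omega]
    simp only [Nat.mul_mod_right, beq_self_eq_true, if_true]
    omega
  · obtain ⟨w, rfl⟩ : ∃ w, y = 2 * w + 1 := ⟨y / 2, by omega⟩
    rw [bitDisjoint_even_odd] at h
    rw [reps_even_odd_odd, show (2 * w + 1) / 2 = w by omega,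
      show (2 * w + 1) % 2 = 1 by omega]
    rcases Nat.eq_zero_or_pos w with rfl | hw
    · simp [reps_zero]
    simpa using ih w (by omega) hw h (by omega)
  · obtain ⟨w, rfl⟩ : ∃ w, y = 2 * w + 1 := ⟨y / 2, by omega⟩
    rw [bitDisjoint_odd_even] at h
    rw [reps_odd_even_odd, show (2 * w + 1) / 2 = w by omega,
      show (2 * w + 1) % 2 = 1 by omega]
    rcases Nat.eq_zero_or_pos w with rfl | hw
    · simp [reps_zero]
    simpa using ih w (by omega) hw h (by omega)
  · exact absurd h (not_bitDisjoint_odd_odd _ _)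

/-! ### Ulam words as words with exactly one admissible cut -/

lemma length_of_mem_ulamLevel {n : ℕ} {w : List (Fin 2)} (h : w ∈ ulamLevel n) :
    w.length = n ∧ 1 ≤ n := by
  match n with
  | 0 => simp [ulamLevel] at h
  | 1 =>
    rw [ulamLevel] at h
    rcases h with rfl | rfl <;> simp
  | n + 2 =>
    rw [ulamLevel] at h
    exact ⟨h.1, by omega⟩

lemma IsUlamWord.length_pos {w : List (Fin 2)} (h : IsUlamWord w) : 1 ≤ w.length := by
  obtain ⟨n, hn⟩ := h
  have := length_of_mem_ulamLevel hn
  omega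

lemma exists_mem_ulamLevel_lt_iff {n : ℕ} {w : List (Fin 2)} (hw : w.length < n) :
    (∃ i, ∃ _ : i < n, w ∈ ulamLevel i) ↔ IsUlamWord w := by
  constructor
  · rintro ⟨i, -, h⟩
    exact ⟨i, h⟩
  · rintro ⟨i, h⟩
    exact ⟨i, by have := length_of_mem_ulamLevel h; omega, h⟩

lemma isUlamWord_singleton (a : Fin 2) : IsUlamWord [a] := by
  refine ⟨1, ?_⟩
  rw [ulamLevel]
  fin_cases a <;> simp

/-- Ulam words are nonempty, so both factors are automatically shorter than w and the length bounds
can be dropped. -/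
lemma isUlamWord_iff_existsUnique {w : List (Fin 2)} (hw : 2 ≤ w.length) :
    IsUlamWord w ↔ ∃! p : List (Fin 2) × List (Fin 2),
      p.1 ++ p.2 = w ∧ p.1 ≠ p.2 ∧ IsUlamWord p.1 ∧ IsUlamWord p.2 := by
  obtain ⟨n, hn⟩ : ∃ n, w.length = n + 2 := ⟨w.length - 2, by omega⟩
  have key : IsUlamWord w ↔ w ∈ ulamLevel (n + 2) := by
    constructor
    · rintro ⟨m, hm⟩
      have := (length_of_mem_ulamLevel hm).1
      rwa [← hn, this]
    · exact fun h => ⟨_, h⟩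
  rw [key, ulamLevel, Set.mem_ofPred_eq, and_iff_right hn]
  refine existsUnique_congr fun p => and_congr_right fun hp => and_congr_right fun _ => ?_
  have hlen : p.1.length + p.2.length = n + 2 := by rw [← hn, ← hp, List.length_append]
  constructor
  · rintro ⟨⟨i, hi, h1⟩, ⟨j, hj, h2⟩⟩
    exact ⟨⟨i, h1⟩, ⟨j, h2⟩⟩
  · rintro ⟨h1, h2⟩
    have := h1.length_pos
    have := h2.length_pos
    exact ⟨(exists_mem_ulamLevel_lt_iff (by omega)).2 h1,
      (exists_mem_ulamLevel_lt_iff (by omega)).2 h2⟩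

/-- Cutting `w` after `n` letters gives two distinct Ulam words. -/
def IsCut (w : List (Fin 2)) (n : ℕ) : Prop :=
  w.take n ≠ w.drop n ∧ IsUlamWord (w.take n) ∧ IsUlamWord (w.drop n)

lemma isUlamWord_iff_sum {w : List (Fin 2)} (hw : 2 ≤ w.length) :
    IsUlamWord w ↔ ∑ n ∈ range (w.length + 1), ind (IsCut w n) = 1 := by
  classical
  have hsum : ∑ n ∈ range (w.length + 1), ind (IsCut w n) =
      #{n ∈ range (w.length + 1) | IsCut w n} := by
    rw [card_filter]
    exact sum_congr rfl fun n _ => by unfold ind; congr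
  rw [hsum, isUlamWord_iff_existsUnique hw, card_eq_one]
  have hmem : ∀ n, n ∈ ({n ∈ range (w.length + 1) | IsCut w n} : Finset ℕ) ↔
      n < w.length + 1 ∧ IsCut w n := by simp
  constructor
  · rintro ⟨p, ⟨rfl, hne, h1, h2⟩, hu⟩
    refine ⟨p.1.length, ?_⟩
    ext n
    rw [hmem, Finset.mem_singleton]
    constructor
    · rintro ⟨hn, hc⟩
      have := hu (_, _) ⟨List.take_append_drop n _, hc⟩
      rw [← this, List.length_take]
      omega
    · rintro rfl
      refine ⟨by simp, ?_⟩
      simpa [IsCut] using ⟨hne, h1, h2⟩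
  · rintro ⟨n, hn⟩
    have hc := ((hmem n).1 (by rw [hn]; simp)).2
    refine ⟨(w.take n, w.drop n), ⟨List.take_append_drop n w, hc⟩, ?_⟩
    rintro ⟨u, v⟩ ⟨rfl, hne, h1, h2⟩
    have : u.length ∈ ({n ∈ range ((u ++ v).length + 1) | IsCut (u ++ v) n} : Finset ℕ) := by
      rw [hmem]
      refine ⟨by simp, ?_⟩
      simpa [IsCut] using ⟨hne, h1, h2⟩
    rw [hn, Finset.mem_singleton] at this
    simp [← this]

lemma isUlamWord_replicate_zero (n : ℕ) :
    IsUlamWord (List.replicate n (0 : Fin 2)) ↔ n = 1 := by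
  induction n using Nat.strong_induction_on with
  | _ n ih =>
  rcases Nat.lt_or_ge n 2 with hn | hn
  · interval_cases n
    · simpa using fun h : IsUlamWord [] => absurd h.length_pos (by simp)
    · simpa using isUlamWord_singleton 0
  · rw [isUlamWord_iff_sum (by simpa using hn), sum_eq_zero]
    · omega
    · rintro i -
      refine ind_false ?_
      rintro ⟨hne, h1, h2⟩
      have l1 := h1.length_pos
      have l2 := h2.length_pos
      rw [List.take_replicate] at *
      rw [List.drop_replicate] at *
      simp only [List.length_replicate] at l1 l2
      rw [ih _ (by omega)] at h1 h2
      exact hne (by rw [h1, h2])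

lemma sum_eq_ind_of_left {f : ℕ → ℕ} {n : ℕ} {p : Prop} (h : ∀ i ≤ n, i ≠ 1 → f i = 0)
    (h1 : 1 ≤ n → f 1 = ind p) : ∑ i ∈ range (n + 1), f i = ind (1 ≤ n ∧ p) := by
  rcases Nat.eq_zero_or_pos n with rfl | hn
  · simp [h 0 le_rfl (by norm_num), ind_false]
  · rw [sum_eq_single_of_mem 1 (by simp; omega) fun i hi hi1 => h i (by simp at hi; omega) hi1,
      h1 hn]
    exact ind_congr (and_iff_right hn).symm

lemma sum_eq_ind_of_right {f : ℕ → ℕ} {n : ℕ} {p : Prop}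
    (h : ∀ i ≤ n, i + 1 ≠ n → f i = 0)
    (h1 : 1 ≤ n → f (n - 1) = ind p) : ∑ i ∈ range (n + 1), f i = ind (1 ≤ n ∧ p) := by
  rw [← sum_range_reflect]
  refine sum_eq_ind_of_left (fun i hi hi1 => h _ (by omega) (by omega)) fun hn => ?_
  rw [← h1 hn]
  congr 1

/-! ### Words with a single one -/

/-- The word `0^a 1 0^b`. -/
def oneWord (a b : ℕ) : List (Fin 2) := List.replicate a 0 ++ ([1] ++ List.replicate b 0)

lemma isCut_append {u v : List (Fin 2)} {n : ℕ} (hn : n = u.length) :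
    IsCut (u ++ v) n ↔ u ≠ v ∧ IsUlamWord u ∧ IsUlamWord v := by
  subst hn
  simp [IsCut]

lemma oneWord_eq_left {a b n : ℕ} (h : n ≤ a) :
    oneWord a b = List.replicate n 0 ++ oneWord (a - n) b := by
  conv_lhs => rw [← Nat.add_sub_cancel' h]
  simp only [oneWord, List.replicate_add, List.append_assoc]

lemma oneWord_eq_right {a b n : ℕ} (h : n ≤ b) :
    oneWord a b = oneWord a n ++ List.replicate (b - n) 0 := by
  conv_lhs => rw [← Nat.add_sub_cancel' h]
  simp only [oneWord, List.replicate_add, List.append_assoc]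

lemma word_eq_left {x y z n : ℕ} (h : n ≤ x) :
    word x y z = List.replicate n 0 ++ word (x - n) y z := by
  conv_lhs => rw [← Nat.add_sub_cancel' h]
  simp only [word, List.replicate_add, List.append_assoc]

lemma word_eq_right {x y z n : ℕ} (h : n ≤ z) :
    word x y z = word x y n ++ List.replicate (z - n) 0 := by
  conv_lhs => rw [← Nat.add_sub_cancel' h]
  simp only [word, List.replicate_add, List.append_assoc]

lemma word_eq_middle {x y z n : ℕ} (h : n ≤ y) :
    word x y z = oneWord x n ++ oneWord (y - n) z := by
  conv_lhs => rw [← Nat.add_sub_cancel' h]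
  simp only [word, oneWord, List.replicate_add, List.append_assoc]

lemma length_oneWord (a b : ℕ) : (oneWord a b).length = a + (1 + b) := by
  simp [oneWord, add_comm]

lemma length_word (x y z : ℕ) : (word x y z).length = x + y + z + 2 := by
  simp [word]; omega

lemma count_one_oneWord (a b : ℕ) : (oneWord a b).count 1 = 1 := by
  simp [oneWord, List.count_replicate]

lemma count_one_word (x y z : ℕ) : (word x y z).count 1 = 2 := by
  simp [word, List.count_replicate]

lemma count_one_replicate (n : ℕ) : (List.replicate n (0 : Fin 2)).count 1 = 0 := by
  simp [List.count_replicate]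

lemma replicate_ne_oneWord (n a b : ℕ) : List.replicate n 0 ≠ oneWord a b := fun h => by
  have := congrArg (List.count 1) h
  rw [count_one_oneWord, count_one_replicate] at this
  omega

lemma replicate_ne_word (n x y z : ℕ) : List.replicate n 0 ≠ word x y z := fun h => by
  have := congrArg (List.count 1) h
  rw [count_one_word, count_one_replicate] at this
  omega

lemma oneWord_inj {a b c d : ℕ} : oneWord a b = oneWord c d ↔ a = c ∧ b = d := by
  constructor
  · intro h
    have h1 : ∀ a b, (oneWord a b).idxOf 1 = a := fun a b => by
      induction a with
      | zero => simp [oneWord]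
      | succ n ih => simpa [oneWord, List.replicate_succ, List.idxOf_cons] using ih
    have h2 := congrArg (List.idxOf 1) h
    have h3 := congrArg List.length h
    rw [h1, h1] at h2
    rw [length_oneWord, length_oneWord] at h3
    omega
  · rintro ⟨rfl, rfl⟩
    rfl

lemma isUlamWord_oneWord_iff_sum {a b : ℕ} (h : 1 ≤ a + b) :
    IsUlamWord (oneWord a b) ↔
      ind (1 ≤ a ∧ IsUlamWord (oneWord (a - 1) b)) +
        ind (1 ≤ b ∧ IsUlamWord (oneWord a (b - 1))) = 1 := by
  rw [isUlamWord_iff_sum (by rw [length_oneWord]; omega), length_oneWord,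
    show a + (1 + b) + 1 = (a + 1) + (b + 1) by ring, sum_range_add]
  congr! 2
  · refine sum_eq_ind_of_left (fun i hi hi1 => ind_false ?_) fun ha => ind_congr ?_
    · rw [oneWord_eq_left hi, isCut_append (by simp), isUlamWord_replicate_zero]
      exact fun h => hi1 h.2.1
    · rw [oneWord_eq_left ha, isCut_append (by simp), isUlamWord_replicate_zero]
      exact ⟨fun h => h.2.2, fun h => ⟨replicate_ne_oneWord _ _ _, rfl, h⟩⟩
  · refine sum_eq_ind_of_right (fun i hi hi1 => ind_false ?_) fun hb => ind_congr ?_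
    · rw [oneWord_eq_right hi, isCut_append (by rw [length_oneWord]; omega),
        isUlamWord_replicate_zero]
      exact fun h => hi1 (by omega)
    · rw [oneWord_eq_right (Nat.sub_le b 1), isCut_append (by rw [length_oneWord]; omega),
        isUlamWord_replicate_zero]
      exact ⟨fun h => h.2.1, fun h => ⟨(replicate_ne_oneWord _ _ _).symm, h, Nat.sub_sub_self hb⟩⟩

lemma isUlamWord_oneWord (a b : ℕ) : IsUlamWord (oneWord a b) ↔ BitDisjoint a b := by
  induction hn : a + b using Nat.strong_induction_on generalizing a b with
  | _ n ih =>
  rcases Nat.eq_zero_or_pos (a + b) with h | h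
  · obtain rfl : a = 0 := by omega
    obtain rfl : b = 0 := by omega
    simpa [oneWord] using isUlamWord_singleton 1
  · rw [isUlamWord_oneWord_iff_sum h, bitDisjoint_pascal a b h]
    have e1 : (1 ≤ a ∧ IsUlamWord (oneWord (a - 1) b)) ↔ (1 ≤ a ∧ BitDisjoint (a - 1) b) :=
      and_congr_right fun ha => ih _ (by omega) _ _ rfl
    have e2 : (1 ≤ b ∧ IsUlamWord (oneWord a (b - 1))) ↔ (1 ≤ b ∧ BitDisjoint a (b - 1)) :=
      and_congr_right fun hb => ih _ (by omega) _ _ rfl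
    rw [ind_congr e1, ind_congr e2]

/-! ### Words with two ones -/

/-- The number of ways to cut `0^x 1 0^y 1 0^z` between the two ones into distinct Ulam words. -/
noncomputable def middleCuts (x z y : ℕ) : ℕ :=
  ∑ i ∈ range (y + 1), ind (¬ (x = y - i ∧ i = z) ∧ BitDisjoint x i ∧ BitDisjoint (y - i) z)

lemma mem_ulamSet_iff_sum (x z y : ℕ) :
    (x, z) ∈ ulamSet y ↔
      ind (1 ≤ x ∧ (x - 1, z) ∈ ulamSet y) + middleCuts x z y +
        ind (1 ≤ z ∧ (x, z - 1) ∈ ulamSet y) = 1 := by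
  change IsUlamWord (word x y z) ↔ _
  rw [isUlamWord_iff_sum (by rw [length_word]; omega), length_word,
    show x + y + z + 2 + 1 = (x + 1) + (y + 1) + (z + 1) by ring, sum_range_add, sum_range_add]
  congr! 2
  · congr 1
    · refine sum_eq_ind_of_left (fun i hi hi1 => ind_false ?_) fun ha => ind_congr ?_
      · rw [word_eq_left hi, isCut_append (by simp), isUlamWord_replicate_zero]
        exact fun h => hi1 h.2.1
      · rw [word_eq_left ha, isCut_append (by simp), isUlamWord_replicate_zero]
        exact ⟨fun h => h.2.2, fun h => ⟨replicate_ne_word _ _ _ _, rfl, h⟩⟩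
    · refine sum_congr rfl fun i hi => ind_congr ?_
      have hi := mem_range.1 hi
      rw [word_eq_middle (n := i) (by omega), isCut_append (by rw [length_oneWord]; omega),
        isUlamWord_oneWord, isUlamWord_oneWord, Ne, oneWord_inj]
  · refine sum_eq_ind_of_right (fun i hi hi1 => ind_false ?_) fun hb => ind_congr ?_
    · rw [word_eq_right hi, isCut_append (by rw [length_word]; omega),
        isUlamWord_replicate_zero]
      exact fun h => hi1 (by omega)
    · rw [word_eq_right (Nat.sub_le z 1), isCut_append (by rw [length_word]; omega),
        isUlamWord_replicate_zero]
      exact ⟨fun h => h.2.1, fun h => ⟨(replicate_ne_word _ _ _ _).symm, h, Nat.sub_sub_self hb⟩⟩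

lemma middleCuts_eq_reps {x z y : ℕ} (h : ¬ (x + z = y ∧ BitDisjoint x z)) :
    middleCuts x z y = reps x z y := by
  refine sum_congr rfl fun i hi => ind_congr (and_iff_right_of_imp ?_)
  have hi := mem_range.1 hi
  rintro ⟨h1, -⟩ ⟨h2, rfl⟩
  exact h ⟨by omega, h1⟩

/-- The cut at i = z produces two copies of 0^x 1 0^z, which the distinctness condition rejects. -/
lemma middleCuts_add_one {x z y : ℕ} (h : x + z = y) (hd : BitDisjoint x z) :
    middleCuts x z y + 1 = reps x z y := by
  have hz : z ∈ range (y + 1) := by simp; omega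
  unfold middleCuts reps
  rw [← add_sum_erase _ _ hz, ← add_sum_erase _ _ hz, ind_false, ind_true, zero_add, add_comm]
  · congr 1
    refine sum_congr rfl fun i hi => ind_congr (and_iff_right ?_)
    exact fun h' => (Finset.mem_erase.1 hi).1 h'.2
  · rw [show y - z = x by omega]
    exact ⟨hd, hd⟩
  · exact fun h' => h'.1 ⟨by omega, rfl⟩

/-! ### The periodic solution of the recurrence -/

lemma bitDisjoint_of_complement {n a b : ℕ} (h : a + b + 1 = 2 ^ n) : BitDisjoint a b := by
  induction n generalizing a b with
  | zero =>
    obtain rfl : a = 0 := by simp at h; omega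
    simp
  | succ n ih =>
    rw [pow_succ] at h
    rw [bitDisjoint_iff]
    exact ⟨by omega, ih (by omega)⟩

lemma sub_one_mod {x T : ℕ} (hT : 1 ≤ T) (hx : 1 ≤ x) :
    (1 ≤ x % T ∧ (x - 1) % T = x % T - 1) ∨ (x % T = 0 ∧ (x - 1) % T = T - 1) := by
  obtain ⟨x, rfl⟩ : ∃ v, x = v + 1 := ⟨x - 1, by omega⟩
  rw [Nat.add_sub_cancel]
  have hlt := Nat.mod_lt x hT
  rcases Nat.lt_or_ge (x % T + 1) T with h | h
  · rw [Nat.add_mod_of_add_mod_lt (by rcases Nat.lt_or_ge 1 T with h1 | h1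
                                      · rwa [Nat.mod_eq_of_lt h1]
                                      · omega)]
    rw [Nat.mod_eq_of_lt (show 1 < T by omega)]
    omega
  · right
    refine ⟨?_, by omega⟩
    rw [Nat.add_mod, show x % T = T - 1 by omega]
    rcases Nat.lt_or_ge 1 T with h1 | h1
    · rw [Nat.mod_eq_of_lt h1, Nat.sub_add_cancel hT, Nat.mod_self]
    · rw [show T = 1 by omega, Nat.mod_one]

/-- The condition that is equivalent to membership in `ulamSet y` away from finitely many
antidiagonals. -/
def Generic (k y x z : ℕ) : Prop :=
  2 ^ (k + 1) ≤ x % 2 ^ (k + 1) + z % 2 ^ (k + 1) + 1 ∧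
    x % 2 ^ (k + 1) + z % 2 ^ (k + 1) + y + 2 ≤ 2 * 2 ^ (k + 1) ∧
    Odd (x % 2 ^ (k + 1) + z % 2 ^ (k + 1)) ∧ reps x z y = 1

section

variable {k y : ℕ} (hky : 2 ^ k ≤ y) (hyk : y < 2 ^ (k + 1))

include hky hyk

lemma reps_mod_ne_one {x z : ℕ}
    (h : x % 2 ^ (k + 1) + z % 2 ^ (k + 1) + 2 ≤ 2 ^ (k + 1)) : reps x z y ≠ 1 := by
  rw [← reps_mod x z hyk]
  exact reps_ne_one h hky hyk

lemma generic_iff_sum (x z : ℕ) :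
    Generic k y x z ↔
      ind (1 ≤ x ∧ Generic k y (x - 1) z) + reps x z y +
        ind (1 ≤ z ∧ Generic k y x (z - 1)) = 1 := by
  have hpow : 2 ^ (k + 1) = 2 * 2 ^ k := by rw [pow_succ, mul_comm]
  have hk := Nat.two_pow_pos k
  have hT : 1 ≤ 2 ^ (k + 1) := Nat.two_pow_pos _
  have hr := reps_mod x z hyk
  have hr1 := reps_mod (x - 1) z hyk
  have hr2 := reps_mod x (z - 1) hyk
  have hpx := sub_one_mod (x := x) hT
  have hpz := sub_one_mod (x := z) hT
  have hx0 : 1 ≤ x % 2 ^ (k + 1) → 1 ≤ x := fun h => by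
    have := Nat.mod_le x (2 ^ (k + 1)); omega
  have hz0 : 1 ≤ z % 2 ^ (k + 1) → 1 ≤ z := fun h => by
    have := Nat.mod_le z (2 ^ (k + 1)); omega
  have hlow := reps_mod_ne_one hky hyk (x := x) (z := z)
  have hxm : x % 2 ^ (k + 1) % 2 = x % 2 := by
    rw [hpow, Nat.mod_mul_right_mod]
  have hzm : z % 2 ^ (k + 1) % 2 = z % 2 := by
    rw [hpow, Nat.mod_mul_right_mod]
  have hxlt := Nat.mod_lt x hT
  have hzlt := Nat.mod_lt z hT
  unfold Generic
  generalize hTdef : 2 ^ (k + 1) = T at *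
  generalize hadef : x % T = a at *
  generalize hbdef : z % T = b at *
  simp only [Nat.odd_iff]
  -- Below the band the count is not 1. If it is 0, then a and b are positive, so neither decrement
  -- wraps around and both neighbours are also below the band.
  rcases Nat.lt_or_ge (a + b + 1) T with h1 | h1
  · refine iff_of_false (by omega) ?_
    have hne := hlow (by omega)
    rcases Nat.eq_zero_or_pos (reps x z y) with h0 | h0
    · have ha : 1 ≤ a := by
        by_contra ha
        have := reps_pos_of_left_zero b y
        rw [show a = 0 by omega] at hr
        omega
      have hb : 1 ≤ b := by
        by_contra hb
        have := reps_pos_of_left_zero a y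
        rw [show b = 0 by omega, reps_comm] at hr
        omega
      rw [ind_false (by omega), ind_false (by omega)]
      omega
    · omega
  rcases Nat.lt_or_ge (a + b) T with h2 | h2
  · have h1r : reps x z y = 1 := by
      rw [← hr]; exact reps_complement (n := k + 1) (by omega) (by omega)
    rw [ind_false (by omega), ind_false (by omega)]
    omega
  -- From here a + b ≥ T with a, b < T, so both residues are positive and decrements do not wrap.
  have hx1 := hx0 (by omega)
  have hz1 := hz0 (by omega)
  have hpx := hpx hx1
  have hpz := hpz hz1
  rw [show (x - 1) % T = a - 1 by omega] at hr1 ⊢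
  rw [show (z - 1) % T = b - 1 by omega] at hr2 ⊢
  rcases Nat.lt_or_ge (2 * T) (a + b + y + 2) with h3 | h3
  · refine iff_of_false (by omega) ?_
    have h0 : reps x z y = 0 := by
      rw [← hr]
      exact reps_eq_zero (n := k + 1) (by omega) (by omega) (by omega) (by omega)
    -- Just past the upper edge, even parity puts both neighbours on the extremal antidiagonal and
    -- the total is 2; otherwise it is 0.
    by_cases h4 : a + b + y + 1 = 2 * T ∧ (a + b) % 2 = 0
    · have e1 : reps (x - 1) z y = 1 := by
        rw [← hr1]
        exact reps_extremal (n := k + 1) (by omega) (by omega) (by omega) (by omega)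
      have e2 : reps x (z - 1) y = 1 := by
        rw [← hr2]
        exact reps_extremal (n := k + 1) (by omega) (by omega) (by omega) (by omega)
      rw [ind_true (by omega), ind_true (by omega)]
      omega
    · rw [ind_false (by omega), ind_false (by omega)]
      omega
  -- For even a + b a total of 1 is impossible: count 0 makes the neighbours equal, and count 1
  -- comes with a generic neighbour. For odd a + b the neighbours fail by parity, leaving the count
  -- alone.
  rcases Nat.mod_two_eq_zero_or_one (a + b) with h4 | h4
  · refine iff_of_false (by omega) ?_
    have e0 := reps_pred_eq_of_zero (y := y) hx1 hz1
    have e1 := reps_pred_of_one (y := y) hx1 hz1 (Nat.even_iff.2 (by omega))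
    rw [ind_congr (p := 1 ≤ x ∧ _) (q := reps (x - 1) z y = 1) (by omega),
      ind_congr (p := 1 ≤ z ∧ _) (q := reps x (z - 1) y = 1) (by omega)]
    intro hs
    rcases Nat.lt_or_ge 1 (reps x z y) with h5 | h5
    · omega
    rcases Nat.eq_zero_or_pos (reps x z y) with h6 | h6
    · rw [e0 h6] at hs
      omega
    · rcases e1 (by omega) with h7 | h7 <;> rw [ind_true h7] at hs <;> omega
  · rw [ind_false (by omega), ind_false (by omega)]
    omega

/-! ### Comparison of Ulam membership with the periodic solution -/

omit hky hyk in
lemma not_generic_of_low {x z : ℕ} (h : x + z + 2 ≤ 2 ^ (k + 1)) : ¬ Generic k y x z := by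
  rintro ⟨h1, -⟩
  rw [Nat.mod_eq_of_lt (by omega), Nat.mod_eq_of_lt (by omega)] at h1
  omega

lemma mem_ulamSet_iff_generic_step {x z : ℕ} (h : x + z ≠ y)
    (h1 : 1 ≤ x → ((x - 1, z) ∈ ulamSet y ↔ Generic k y (x - 1) z))
    (h2 : 1 ≤ z → ((x, z - 1) ∈ ulamSet y ↔ Generic k y x (z - 1))) :
    (x, z) ∈ ulamSet y ↔ Generic k y x z := by
  rw [mem_ulamSet_iff_sum, generic_iff_sum hky hyk, middleCuts_eq_reps (fun h' => h h'.1),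
    ind_congr (and_congr_right h1), ind_congr (and_congr_right h2)]

lemma mem_ulamSet_iff_generic_of_lt {x z : ℕ} (h : x + z < y) :
    (x, z) ∈ ulamSet y ↔ Generic k y x z := by
  induction hn : x + z using Nat.strong_induction_on generalizing x z with
  | _ n ih =>
  exact mem_ulamSet_iff_generic_step hky hyk (by omega)
    (fun hx => ih _ (by omega) (by omega) rfl) (fun hz => ih _ (by omega) (by omega) rfl)

lemma mem_ulamSet_iff_generic_of_le {m : ℕ} (hm : y ≤ m)
    (h : ∀ x z, x + z = m → ((x, z) ∈ ulamSet y ↔ Generic k y x z)) {x z : ℕ}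
    (hxz : m ≤ x + z) : (x, z) ∈ ulamSet y ↔ Generic k y x z := by
  induction hn : x + z using Nat.strong_induction_on generalizing x z with
  | _ n ih =>
  rcases hxz.eq_or_lt with h' | h'
  · exact h x z h'.symm
  exact mem_ulamSet_iff_generic_step hky hyk (by omega)
    (fun hx => ih _ (by omega) (by omega) rfl) (fun hz => ih _ (by omega) (by omega) rfl)

lemma mem_ulamSet_iff_middleCuts {x z : ℕ} (h : x + z = y) :
    (x, z) ∈ ulamSet y ↔ middleCuts x z y = 1 := by
  rw [mem_ulamSet_iff_sum, ind_false, ind_false, zero_add, add_zero]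
  · rintro ⟨hz, hu⟩
    rw [mem_ulamSet_iff_generic_of_lt hky hyk (by omega)] at hu
    exact not_generic_of_low (by omega) hu
  · rintro ⟨hz, hu⟩
    rw [mem_ulamSet_iff_generic_of_lt hky hyk (by omega)] at hu
    exact not_generic_of_low (by omega) hu

/-- Neighbours on antidiagonal y - 1 are not members. For disjoint x, z the equal halves cost one
cut; otherwise no cut is lost and `reps_ne_one` excludes membership. -/
lemma mem_ulamSet_iff_reps_eq_two (hy : y + 2 ≤ 2 ^ (k + 1)) {x z : ℕ} (h : x + z = y) :
    (x, z) ∈ ulamSet y ↔ BitDisjoint x z ∧ reps x z y = 2 := by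
  rw [mem_ulamSet_iff_middleCuts hky hyk h]
  by_cases hd : BitDisjoint x z
  · have := middleCuts_add_one h hd
    rw [and_iff_right hd]
    omega
  · rw [middleCuts_eq_reps (fun h' => hd h'.2)]
    exact iff_of_false (reps_ne_one (by omega) hky hyk) (fun h' => hd h'.1)

lemma isZumkeller_of_mem_ulamSet (hy : y + 2 ≤ 2 ^ (k + 1)) {x z : ℕ} (h : x + z = y)
    (hu : (x, z) ∈ ulamSet y) : IsZumkeller y := by
  have hpos : 0 < y := (Nat.two_pow_pos k).trans_le hky
  obtain ⟨hd, h2⟩ := (mem_ulamSet_iff_reps_eq_two hky hyk hy h).1 hu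
  have := count_zero_digits_lt_reps hpos hd h
  exact ⟨hpos, by omega⟩

lemma mem_ulamSet_iff_generic_of_add_three_le (hy : y + 3 ≤ 2 ^ (k + 1)) {x z : ℕ}
    (h : x + z ≠ y) : (x, z) ∈ ulamSet y ↔ Generic k y x z := by
  rcases Nat.lt_or_ge (x + z) y with hlt | hge
  · exact mem_ulamSet_iff_generic_of_lt hky hyk hlt
  refine mem_ulamSet_iff_generic_of_le hky hyk (m := y + 1) (by omega) ?_ (by omega)
  clear hge h x z
  intro x z h
  refine iff_of_false ?_ (not_generic_of_low (by omega))
  rw [mem_ulamSet_iff_sum, middleCuts_eq_reps (by omega)]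
  have hne : reps x z y ≠ 1 := reps_ne_one (by omega) hky hyk
  -- With count 0, the two neighbours on antidiagonal y have equal disjointness and equal counts, so
  -- they contribute 0 or 2. This is why the disturbance does not spread to y + 1.
  rcases Nat.eq_zero_or_pos (reps x z y) with h0 | h0
  · have hd : ¬ BitDisjoint x z := fun hd => by
      have := reps_pos y hd
      omega
    have hx : 1 ≤ x := Nat.one_le_iff_ne_zero.2 (by rintro rfl; simp at hd)
    have hz : 1 ≤ z := Nat.one_le_iff_ne_zero.2 (by rintro rfl; simp at hd)
    rw [mem_ulamSet_iff_reps_eq_two hky hyk (by omega) (by omega),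
      mem_ulamSet_iff_reps_eq_two hky hyk (by omega) (by omega), bitDisjoint_sub_one hx hz hd,
      reps_pred_eq_of_zero hx hz h0]
    simp only [hx, hz, true_and]
    omega
  · omega

lemma not_mem_ulamSet_of_zero {x z : ℕ} (hxz : x + z ≠ y)
    (h : x % 2 ^ (k + 1) + z % 2 ^ (k + 1) + 2 ≤ 2 ^ (k + 1))
    (h0 : x % 2 ^ (k + 1) = 0 ∨ z % 2 ^ (k + 1) = 0) : (x, z) ∉ ulamSet y := by
  have h1 := reps_mod_ne_one hky hyk h
  have h2 : 1 ≤ reps x z y := by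
    rw [← reps_mod x z hyk]
    rcases h0 with h0 | h0 <;> rw [h0]
    · exact reps_pos_of_left_zero _ _
    · rw [reps_comm]; exact reps_pos_of_left_zero _ _
  rw [mem_ulamSet_iff_sum, middleCuts_eq_reps (fun h' => hxz h'.1)]
  omega

/-- The single cut between the ones is the one into equal halves, so none remains. -/
lemma not_mem_ulamSet_of_add_one_eq (hy : y + 1 = 2 ^ (k + 1)) {x z : ℕ} (h : x + z = y) :
    (x, z) ∉ ulamSet y := by
  have := middleCuts_add_one h (bitDisjoint_of_complement (n := k + 1) (by omega))
  rw [reps_complement (n := k + 1) (by omega) hyk] at this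
  rw [mem_ulamSet_iff_middleCuts hky hyk h]
  omega

lemma mem_ulamSet_iff_generic_of_add_one_eq (hy : y + 1 = 2 ^ (k + 1)) {x z : ℕ}
    (h : x + z ≠ y) : (x, z) ∈ ulamSet y ↔ Generic k y x z := by
  rcases Nat.lt_or_ge (x + z) y with hlt | hge
  · exact mem_ulamSet_iff_generic_of_lt hky hyk hlt
  refine mem_ulamSet_iff_generic_of_le hky hyk (m := y + 1) (by omega) ?_ (by omega)
  clear hge h x z
  intro x z h
  have hk := Nat.two_pow_pos k
  by_cases h0 : x = 0 ∨ z = 0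
  · have hx : x % 2 ^ (k + 1) = 0 := by
      rcases h0 with rfl | rfl
      · exact Nat.zero_mod _
      · rw [show x = 2 ^ (k + 1) by omega, Nat.mod_self]
    have hz : z % 2 ^ (k + 1) = 0 := by
      rcases h0 with rfl | rfl
      · rw [show z = 2 ^ (k + 1) by omega, Nat.mod_self]
      · exact Nat.zero_mod _
    refine iff_of_false (not_mem_ulamSet_of_zero hky hyk (by omega) (by omega) (by omega)) ?_
    rintro ⟨h1, -⟩
    omega
  · refine iff_of_false ?_ ?_
    · have hr : reps x z y = 0 :=
        reps_eq_zero (n := k + 1) (by omega) (by omega) hyk (by omega)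
      rw [mem_ulamSet_iff_sum, middleCuts_eq_reps (by omega), hr, ind_false, ind_false]
      · omega
      · exact fun h' => not_mem_ulamSet_of_add_one_eq hky hyk hy (by omega) h'.2
      · exact fun h' => not_mem_ulamSet_of_add_one_eq hky hyk hy (by omega) h'.2
    · rintro ⟨-, h2, -⟩
      rw [Nat.mod_eq_of_lt (by omega), Nat.mod_eq_of_lt (by omega)] at h2
      omega

lemma reps_eq_two_of_add_two_eq (hy : y + 2 = 2 ^ (k + 1)) {x z : ℕ} (h : x + z = y)
    (hx : x % 2 = 0) : BitDisjoint x z ∧ reps x z y = 2 := by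
  have hpow : 2 ^ (k + 1) = 2 * 2 ^ k := by rw [pow_succ, mul_comm]
  have hk := Nat.two_pow_pos k
  obtain ⟨a, rfl⟩ : ∃ a, x = 2 * a := ⟨x / 2, by omega⟩
  obtain ⟨b, rfl⟩ : ∃ b, z = 2 * b := ⟨z / 2, by omega⟩
  obtain ⟨w, rfl⟩ : ∃ w, y = 2 * (w + 1) := ⟨y / 2 - 1, by omega⟩
  rw [bitDisjoint_even_even, reps_even_even_even, reps_complement (n := k) (by omega) (by omega),
    reps_complement (n := k) (by omega) (by omega)]
  exact ⟨bitDisjoint_of_complement (n := k) (by omega), rfl⟩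

lemma mem_ulamSet_of_add_two_eq (hy : y + 2 = 2 ^ (k + 1)) {x z : ℕ} (h : x + z = y)
    (hx : x % 2 = 0) : (x, z) ∈ ulamSet y :=
  (mem_ulamSet_iff_reps_eq_two hky hyk hy.le h).2 (reps_eq_two_of_add_two_eq hky hyk hy h hx)

/-- The count is already 1, and whichever parity x has, one neighbour has even first coordinate and
is a member on antidiagonal y. -/
lemma not_mem_ulamSet_of_add_two_eq (hy : y + 2 = 2 ^ (k + 1)) {x z : ℕ} (h : x + z = y + 1) :
    (x, z) ∉ ulamSet y := by
  have hpow : 2 ^ (k + 1) = 2 * 2 ^ k := by rw [pow_succ, mul_comm]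
  have hr : reps x z y = 1 := reps_complement (n := k + 1) (by omega) hyk
  rw [mem_ulamSet_iff_sum, middleCuts_eq_reps (by omega), hr]
  rcases Nat.mod_two_eq_zero_or_one x with hx | hx
  · rw [ind_true (p := 1 ≤ z ∧ _)
      ⟨by omega, mem_ulamSet_of_add_two_eq hky hyk hy (by omega) hx⟩]
    omega
  · rw [ind_true (p := 1 ≤ x ∧ _)
      ⟨by omega, mem_ulamSet_of_add_two_eq hky hyk hy (by omega) (by omega)⟩]
    omega

lemma mem_ulamSet_of_add_two_eq_of_pos (hy : y + 2 = 2 ^ (k + 1)) {x z : ℕ} (h : x + z = y + 2)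
    (hx : 1 ≤ x) (hz : 1 ≤ z) : (x, z) ∈ ulamSet y := by
  have hr : reps x z y = 1 :=
    reps_extremal (n := k + 1) (by omega) (by omega) hyk (by omega)
  rw [mem_ulamSet_iff_sum, middleCuts_eq_reps (by omega), hr, ind_false, ind_false]
  · exact fun h' => not_mem_ulamSet_of_add_two_eq hky hyk hy (by omega) h'.2
  · exact fun h' => not_mem_ulamSet_of_add_two_eq hky hyk hy (by omega) h'.2

lemma mem_ulamSet_iff_generic_of_add_two_eq (hy : y + 2 = 2 ^ (k + 1)) {x z : ℕ}
    (h : x + z < y ∨ y + 3 ≤ x + z) : (x, z) ∈ ulamSet y ↔ Generic k y x z := by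
  rcases h with hlt | hge
  · exact mem_ulamSet_iff_generic_of_lt hky hyk hlt
  refine mem_ulamSet_iff_generic_of_le hky hyk (m := y + 3) (by omega) ?_ hge
  clear hge x z
  intro x z h
  have hpow : 2 ^ (k + 1) = 2 * 2 ^ k := by rw [pow_succ, mul_comm]
  have hk := Nat.two_pow_pos k
  have hwrap : (x % 2 ^ (k + 1) = 0 ∧ z % 2 ^ (k + 1) = 1) ∨
      (x % 2 ^ (k + 1) = 1 ∧ z % 2 ^ (k + 1) = 0) ∨
      (2 ≤ x ∧ 2 ≤ z ∧ x % 2 ^ (k + 1) = x ∧ z % 2 ^ (k + 1) = z) := by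
    have e1 : (2 ^ (k + 1) + 1) % 2 ^ (k + 1) = 1 := by
      rw [Nat.add_mod_left, Nat.mod_eq_of_lt (by omega)]
    rcases Nat.lt_or_ge x 2 with hx | hx
    · rcases Nat.eq_zero_or_pos x with rfl | hx0
      · left
        rw [show z = 2 ^ (k + 1) + 1 by omega]
        exact ⟨Nat.zero_mod _, e1⟩
      · right; left
        rw [show x = 1 by omega, show z = 2 ^ (k + 1) by omega]
        exact ⟨Nat.mod_eq_of_lt (by omega), Nat.mod_self _⟩
    rcases Nat.lt_or_ge z 2 with hz | hz
    · rcases Nat.eq_zero_or_pos z with rfl | hz0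
      · right; left
        rw [show x = 2 ^ (k + 1) + 1 by omega]
        exact ⟨e1, Nat.zero_mod _⟩
      · left
        rw [show z = 1 by omega, show x = 2 ^ (k + 1) by omega]
        exact ⟨Nat.mod_self _, Nat.mod_eq_of_lt (by omega)⟩
    · exact Or.inr (Or.inr ⟨hx, hz, Nat.mod_eq_of_lt (by omega), Nat.mod_eq_of_lt (by omega)⟩)
  have hG : ¬ Generic k y x z := by
    rintro ⟨h1, h2, -⟩
    omega
  refine iff_of_false ?_ hG
  -- In the interior both neighbours on antidiagonal y + 2 are members; near the ends a residue is 0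
  -- and the count is at least 2.
  by_cases h2 : 2 ≤ x ∧ 2 ≤ z
  · rw [mem_ulamSet_iff_sum,
      ind_true ⟨by omega, mem_ulamSet_of_add_two_eq_of_pos hky hyk hy (by omega) (by omega)
        (by omega)⟩,
      ind_true ⟨by omega, mem_ulamSet_of_add_two_eq_of_pos hky hyk hy (by omega) (by omega)
        (by omega)⟩]
    omega
  · exact not_mem_ulamSet_of_zero hky hyk (by omega) (by omega) (by omega)

lemma mem_ulamSet_iff_generic {x z : ℕ} (h0 : x + z ≠ y) (h1 : x + z ≠ y + 1)
    (h2 : x + z ≠ y + 2) : (x, z) ∈ ulamSet y ↔ Generic k y x z := by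
  rcases (by omega : y + 3 ≤ 2 ^ (k + 1) ∨ y + 2 = 2 ^ (k + 1) ∨ y + 1 = 2 ^ (k + 1))
    with h | h | h
  · exact mem_ulamSet_iff_generic_of_add_three_le hky hyk h h0
  · exact mem_ulamSet_iff_generic_of_add_two_eq hky hyk h (by omega)
  · exact mem_ulamSet_iff_generic_of_add_one_eq hky hyk h h0

lemma isZumkeller_of_two_pow_le (h : 2 ^ (k + 1) ≤ y + 2) : IsZumkeller y := by
  have hpos : 0 < y := (Nat.two_pow_pos k).trans_le hky
  have hc := count_zero_digits_lt_reps hpos (bitDisjoint_zero_left y) (zero_add y)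
  refine ⟨hpos, ?_⟩
  rcases (by omega : y + 2 = 2 ^ (k + 1) ∨ y + 1 = 2 ^ (k + 1)) with h | h
  · rw [(reps_eq_two_of_add_two_eq hky hyk h (zero_add y) rfl).2] at hc
    omega
  · rw [reps_complement (n := k + 1) (by omega) hyk] at hc
    omega

lemma mem_ulamSet_iff_generic_of_not_isZumkeller (hy : ¬ IsZumkeller y) {x z : ℕ} :
    (x, z) ∈ ulamSet y ↔ Generic k y x z := by
  have h3 : y + 3 ≤ 2 ^ (k + 1) := by
    by_contra h
    exact hy (isZumkeller_of_two_pow_le hky hyk (by omega))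
  by_cases h : x + z = y
  · exact iff_of_false (fun hu => hy (isZumkeller_of_mem_ulamSet hky hyk (by omega) h hu))
      (not_generic_of_low (by omega))
  · exact mem_ulamSet_iff_generic_of_add_three_le hky hyk h3 h

/-! ### The extreme residue sums and the exceptional y -/

omit hky in
lemma generic_of_complement {x z : ℕ}
    (h : x % 2 ^ (k + 1) + z % 2 ^ (k + 1) + 1 = 2 ^ (k + 1)) : Generic k y x z := by
  have hpow : 2 ^ (k + 1) = 2 * 2 ^ k := by rw [pow_succ, mul_comm]
  refine ⟨by omega, by omega, Nat.odd_iff.2 (by omega), ?_⟩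
  rw [← reps_mod x z hyk]
  exact reps_complement h hyk

omit hky in
lemma generic_of_extremal {x z : ℕ} (hodd : Odd (x % 2 ^ (k + 1) + z % 2 ^ (k + 1)))
    (hy : y + 3 ≤ 2 ^ (k + 1))
    (h : x % 2 ^ (k + 1) + z % 2 ^ (k + 1) + y + 2 = 2 * 2 ^ (k + 1) ∨
      x % 2 ^ (k + 1) + z % 2 ^ (k + 1) + y + 3 = 2 * 2 ^ (k + 1)) : Generic k y x z := by
  have hx := Nat.mod_lt x (Nat.two_pow_pos (k + 1))
  have hz := Nat.mod_lt z (Nat.two_pow_pos (k + 1))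
  refine ⟨by omega, by omega, hodd, ?_⟩
  rw [← reps_mod x z hyk]
  rcases h with h | h
  · exact reps_extremal hx hz hyk h
  · exact reps_subextremal hx hz hyk h hodd

lemma mem_ulamSet_iff_ne_of_complement (hy : y + 1 = 2 ^ (k + 1) ∨ y + 2 = 2 ^ (k + 1)) {x z : ℕ}
    (h : x % 2 ^ (k + 1) + z % 2 ^ (k + 1) + 1 = 2 ^ (k + 1)) :
    (x, z) ∈ ulamSet y ↔ x + z ≠ 2 ^ (k + 1) - 1 := by
  have hpow : 2 ^ (k + 1) = 2 * 2 ^ k := by rw [pow_succ, mul_comm]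
  have hk := Nat.two_pow_pos k
  by_cases hxz : x + z = 2 ^ (k + 1) - 1
  · refine iff_of_false ?_ (not_not.2 hxz)
    rcases hy with hy | hy
    · exact not_mem_ulamSet_of_add_one_eq hky hyk hy (by omega)
    · exact not_mem_ulamSet_of_add_two_eq hky hyk hy (by omega)
  · refine iff_of_true ?_ hxz
    have hG := generic_of_complement hyk h
    rcases hy with hy | hy
    · exact (mem_ulamSet_iff_generic_of_add_one_eq hky hyk hy (by omega)).2 hG
    -- Some quotient is positive, so x + z ≥ 2T - 1 ≥ y + 3, past the disturbed antidiagonals.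
    · have ex := Nat.div_add_mod x (2 ^ (k + 1))
      have ez := Nat.div_add_mod z (2 ^ (k + 1))
      have hpos : x / 2 ^ (k + 1) + z / 2 ^ (k + 1) ≠ 0 := fun h0 => by
        rw [(Nat.add_eq_zero_iff.1 h0).1] at ex
        rw [(Nat.add_eq_zero_iff.1 h0).2] at ez
        omega
      have hmul := Nat.mul_le_mul_left (2 ^ (k + 1)) (Nat.one_le_iff_ne_zero.2 hpos)
      rw [mul_add] at hmul
      exact (mem_ulamSet_iff_generic_of_add_two_eq hky hyk hy (by omega)).2 hG

end

lemma mod_add_mod_of_modEq_neg_one {k x z : ℕ}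
    (h : ((x + z : ℕ) : ℤ) ≡ -1 [ZMOD 2 ^ (k + 1)]) :
    x % 2 ^ (k + 1) + z % 2 ^ (k + 1) + 1 = 2 ^ (k + 1) := by
  have hx := Nat.mod_lt x (Nat.two_pow_pos (k + 1))
  have hz := Nat.mod_lt z (Nat.two_pow_pos (k + 1))
  have h1 : ((2 ^ (k + 1) : ℕ) : ℤ) ∣ ((x + z + 1 : ℕ) : ℤ) := by
    have := h.symm.dvd
    push_cast at this ⊢
    simpa using this
  have h2 : 2 ^ (k + 1) ∣ x % 2 ^ (k + 1) + z % 2 ^ (k + 1) + 1 := by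
    rw [Nat.dvd_iff_mod_eq_zero, Nat.add_mod, ← Nat.add_mod x z, ← Nat.add_mod]
    exact Nat.mod_eq_zero_of_dvd (Int.natCast_dvd_natCast.1 h1)
  obtain ⟨c, hc⟩ := h2
  have : c = 1 := by
    rcases c with _ | _ | c
    · omega
    · rfl
    · have := Nat.mul_le_mul_left (2 ^ (k + 1)) (show 2 ≤ c + 1 + 1 by omega)
      omega
  rw [hc, this, mul_one]

end BinaryUlam

theorem mainTheorem9 (k y : ℕ) (hky : 2 ^ k ≤ y) (hyk : y < 2 ^ (k + 1)) :
    -- part 1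
    (¬ BinaryUlam.IsZumkeller y →
      ∀ x z : ℕ, (x, z) ∈ BinaryUlam.ulamSet y → 2 ^ (k + 1) - 1 ≤ x + z) ∧
    -- part 2
    (¬ BinaryUlam.IsZumkeller y →
      ∀ x z : ℕ, (x, z) ∈ BinaryUlam.ulamSet y →
        2 ^ (k + 1) - 1 ≤ x % 2 ^ (k + 1) + z % 2 ^ (k + 1) ∧
        x % 2 ^ (k + 1) + z % 2 ^ (k + 1) ≤ 2 ^ (k + 2) - y - 2) ∧
    (BinaryUlam.IsZumkeller y →
      ∀ x z : ℕ, (x, z) ∈ BinaryUlam.ulamSet y →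
        x + z ≠ y → x + z ≠ y + 1 → x + z ≠ y + 2 →
        2 ^ (k + 1) - 1 ≤ x % 2 ^ (k + 1) + z % 2 ^ (k + 1) ∧
        x % 2 ^ (k + 1) + z % 2 ^ (k + 1) ≤ 2 ^ (k + 2) - y - 2) ∧
    -- part 3
    (y ≠ 2 ^ (k + 1) - 1 → y ≠ 2 ^ (k + 1) - 2 →
      ∀ x z : ℕ, ((x + z : ℕ) : ℤ) ≡ -1 [ZMOD 2 ^ (k + 1)] →
        (x, z) ∈ BinaryUlam.ulamSet y) ∧
    (y = 2 ^ (k + 1) - 1 ∨ y = 2 ^ (k + 1) - 2 →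
      ∀ x z : ℕ, ((x + z : ℕ) : ℤ) ≡ -1 [ZMOD 2 ^ (k + 1)] →
        ((x, z) ∈ BinaryUlam.ulamSet y ↔ x + z ≠ 2 ^ (k + 1) - 1)) ∧
    -- part 4
    (y ≠ 2 ^ (k + 1) - 1 → y ≠ 2 ^ (k + 1) - 2 →
      ∀ x z : ℕ, Odd (x % 2 ^ (k + 1) + z % 2 ^ (k + 1)) →
        (x % 2 ^ (k + 1) + z % 2 ^ (k + 1) = 2 ^ (k + 2) - y - 2 ∨
          x % 2 ^ (k + 1) + z % 2 ^ (k + 1) = 2 ^ (k + 2) - y - 3) →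
        (x, z) ∈ BinaryUlam.ulamSet y) ∧
    (y = 2 ^ (k + 1) - 1 ∨ y = 2 ^ (k + 1) - 2 →
      ∀ x z : ℕ, Odd (x % 2 ^ (k + 1) + z % 2 ^ (k + 1)) →
        (x % 2 ^ (k + 1) + z % 2 ^ (k + 1) = 2 ^ (k + 2) - y - 2 ∨
          x % 2 ^ (k + 1) + z % 2 ^ (k + 1) = 2 ^ (k + 2) - y - 3) →
        ((x, z) ∈ BinaryUlam.ulamSet y ↔ x + z ≠ 2 ^ (k + 1) - 1)) := by
  have hpow : 2 ^ (k + 2) = 2 * 2 ^ (k + 1) := by rw [pow_succ, mul_comm]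
  have hpow' : 2 ^ (k + 1) = 2 * 2 ^ k := by rw [pow_succ, mul_comm]
  have hk := Nat.two_pow_pos k
  refine ⟨fun hZ x z hu => ?_, fun hZ x z hu => ?_, fun hZ x z hu h0 h1 h2 => ?_,
    fun h1 h2 x z h => ?_, fun hy x z h => ?_, fun h1 h2 x z hodd h => ?_,
    fun hy x z hodd h => ?_⟩
  · obtain ⟨h1, -⟩ :=
      (BinaryUlam.mem_ulamSet_iff_generic_of_not_isZumkeller hky hyk hZ).1 hu
    have := Nat.mod_le x (2 ^ (k + 1))
    have := Nat.mod_le z (2 ^ (k + 1))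
    omega
  · obtain ⟨h1, h2, -⟩ :=
      (BinaryUlam.mem_ulamSet_iff_generic_of_not_isZumkeller hky hyk hZ).1 hu
    omega
  · obtain ⟨h1, h2, -⟩ := (BinaryUlam.mem_ulamSet_iff_generic hky hyk h0 h1 h2).1 hu
    omega
  · have hS := BinaryUlam.mod_add_mod_of_modEq_neg_one h
    have := Nat.mod_le x (2 ^ (k + 1))
    have := Nat.mod_le z (2 ^ (k + 1))
    exact (BinaryUlam.mem_ulamSet_iff_generic_of_add_three_le hky hyk (by omega) (by omega)).2
      (BinaryUlam.generic_of_complement hyk hS)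
  · exact BinaryUlam.mem_ulamSet_iff_ne_of_complement hky hyk (by omega)
      (BinaryUlam.mod_add_mod_of_modEq_neg_one h)
  · have := Nat.mod_le x (2 ^ (k + 1))
    have := Nat.mod_le z (2 ^ (k + 1))
    exact (BinaryUlam.mem_ulamSet_iff_generic_of_add_three_le hky hyk (by omega) (by omega)).2
      (BinaryUlam.generic_of_extremal hyk hodd (by omega) (by omega))
  -- For these two y the odd candidate s equals T - 1, so the claim coincides with the complementary
  -- case.
  · rw [Nat.odd_iff] at hodd
    exact BinaryUlam.mem_ulamSet_iff_ne_of_complement hky hyk (by omega) (by omega)
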